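/- **Theorem.** Let $\alpha\in(0,1)$. An instance of the $\alpha$-bus stop problem consists of a finite set $N$ of $n$ agents, a finite set $V\subseteq\mathbb{Q}$ of potential bus stops, a budget $b\in\mathbb{N}$, and, for each agent $i\in N$, terminal points $\ell_i,r_i\in V$ with $\ell_i<r_i$. For a set $S\subseteq V$, the cost of agent $i$ is $$c_i(S)=\min\Bigl(\{|\ell_i-r_i|\}\cup\bigl\{|\ell_i-x|+\alpha|x-y|+|r_i-y| : x,y\in S\bigr\}\Bigr).$$ Then every such instance has a feasible solution in the $16$-core. That is, there is a set $S\subseteq V$ with $|S|\le b$ such that, for every nonempty set of agents $M\subseteq N$ and every set of stops $T\subseteq V$ with $16\,|T|\le |M|\cdot\frac{b}{n}$, there is an agent $i\in M$ with $c_i(T)\ge c_i(S)$. -/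

import Mathlib

/-- An instance of the bus stop problem whose (finite) set of agents is the type `N`.
The parameter `α` enters only through the travel costs below. -/
structure BusStopInstance (N : Type*) where
  /-- the finite set of potential bus stops -/
  stops : Finset ℚ
  /-- the maximum number of stops that may be built -/
  budget : ℕ
  /-- left terminal point of each agent -/
  left : N → ℚ
  /-- right terminal point of each agent -/
  right : N → ℚ
  left_mem : ∀ i, left i ∈ stops
  right_mem : ∀ i, right i ∈ stops
  left_lt_right : ∀ i, left i < right i

namespace BusStopInstance

/-- The distance `d(x, y) = |x - y|`, as a real number. -/
noncomputable def distance (x y : ℚ) : ℝ := |(x : ℝ) - (y : ℝ)|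

variable {N : Type*}

/-- Cost of agent `i` for walking to stop `x`, riding the bus to stop `y`, and walking on. -/
noncomputable def routeCost (I : BusStopInstance N) (α : ℝ) (i : N) (x y : ℚ) : ℝ :=
  distance (I.left i) x + α * distance x y + distance (I.right i) y

/-- The cost of agent `i` for the set of stops `S`: the minimum of the cost of walking all the way
and of the costs of all bus routes between two (not necessarily distinct) stops of `S`.
If `S` is empty, only walking remains. -/
noncomputable def cost (I : BusStopInstance N) (α : ℝ) (S : Finset ℚ) (i : N) : ℝ :=
  (insert (distance (I.left i) (I.right i))
    ((S ×ˢ S).image fun p => I.routeCost α i p.1 p.2)).min' (Finset.insert_nonempty _ _)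

/-- A solution is a set of potential bus stops. -/
def IsSolution (I : BusStopInstance N) (S : Finset ℚ) : Prop := S ⊆ I.stops

/-- A solution is feasible if it respects the budget. -/
def IsFeasible (I : BusStopInstance N) (S : Finset ℚ) : Prop :=
  I.IsSolution S ∧ S.card ≤ I.budget

/-- `S` is in the `φ`-core: no nonempty group `M` of agents and set `T` of potential stops with
`φ * |T| ≤ |M| * (b / n)` are such that all agents in `M` have strictly smaller cost for `T`. -/
def InApproxCore [Fintype N] (I : BusStopInstance N) (α φ : ℝ) (S : Finset ℚ) : Prop :=
  ∀ M : Finset N, M.Nonempty → ∀ T : Finset ℚ, T ⊆ I.stops →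
    φ * (T.card : ℝ) ≤ (M.card : ℝ) * ((I.budget : ℝ) / (Fintype.card N : ℝ)) →
    ∃ i ∈ M, I.cost α S i ≤ I.cost α T i

end BusStopInstance

namespace BusStopInstance

/-! Place stops so that they cut the `2n` terminals into small groups. With `G = ⌊2n/b⌋`, a greedy
sweep (`exists_finset_separating`) gives at most `b` stops such that any point `t` has at most `G`
terminals with no stop of `S` between them and `t`. An agent who strictly prefers `T` must have a
terminal unseparated from some stop of `T` (`cost_le_cost_of_separated`). So a blocking group has
`|M| ≤ |T| G ≤ 2n|T|/b`, which is too small. -/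

lemma distance_comm (x y : ℚ) : distance x y = distance y x :=
  abs_sub_comm _ _

lemma distance_triangle (x y z : ℚ) : distance x z ≤ distance x y + distance y z :=
  abs_sub_le _ _ _

lemma distance_add_of_mem_uIcc {x y s : ℚ} (hs : s ∈ Set.uIcc x y) :
    distance x s + distance s y = distance x y := by
  unfold distance
  rcases Set.mem_uIcc.1 hs with ⟨h₁, h₂⟩ | ⟨h₁, h₂⟩
  · have h₁ : (x : ℝ) ≤ s := by exact_mod_cast h₁
    have h₂ : (s : ℝ) ≤ y := by exact_mod_cast h₂
    rw [abs_of_nonpos (by linarith), abs_of_nonpos (by linarith), abs_of_nonpos (by linarith)]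
    ring
  · have h₁ : (y : ℝ) ≤ s := by exact_mod_cast h₁
    have h₂ : (s : ℝ) ≤ x := by exact_mod_cast h₂
    rw [abs_of_nonneg (by linarith), abs_of_nonneg (by linarith), abs_of_nonneg (by linarith)]
    ring

variable {N : Type*} (I : BusStopInstance N) {α : ℝ}

/-- Moving the boarding stop towards the left terminal and the exit stop towards the right terminal
does not increase the cost of a route. -/
lemma routeCost_le_of_mem_uIcc (hα₀ : 0 ≤ α) (hα₁ : α ≤ 1) {i : N} {x y s t : ℚ}
    (hs : s ∈ Set.uIcc (I.left i) x) (ht : t ∈ Set.uIcc (I.right i) y) :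
    I.routeCost α i s t ≤ I.routeCost α i x y := by
  have hx := distance_add_of_mem_uIcc hs
  have hy := distance_add_of_mem_uIcc ht
  have hst : distance s t ≤ distance s x + distance x y + distance t y := by
    linarith [distance_triangle s x t, distance_triangle x y t, distance_comm y t]
  have hsx : 0 ≤ distance s x := abs_nonneg _
  have hty : 0 ≤ distance t y := abs_nonneg _
  -- The ride grows by at most `d(s, x) + d(t, y)`, charged at rate `α ≤ 1`; exactly this much
  -- walking is saved.
  unfold routeCost
  nlinarith [mul_le_mul_of_nonneg_left hst hα₀, mul_le_mul_of_nonneg_right hα₁ hsx,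
    mul_le_mul_of_nonneg_right hα₁ hty]

lemma cost_le_walk (S : Finset ℚ) (i : N) :
    I.cost α S i ≤ distance (I.left i) (I.right i) :=
  Finset.min'_le _ _ (Finset.mem_insert_self _ _)

lemma cost_le_routeCost {S : Finset ℚ} (i : N) {x y : ℚ} (hx : x ∈ S) (hy : y ∈ S) :
    I.cost α S i ≤ I.routeCost α i x y :=
  Finset.min'_le _ _ (Finset.mem_insert_of_mem
    (Finset.mem_image_of_mem (fun p : ℚ × ℚ => I.routeCost α i p.1 p.2)
      (Finset.mk_mem_product hx hy)))

lemma le_cost {S : Finset ℚ} {i : N} {c : ℝ} (hw : c ≤ distance (I.left i) (I.right i))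
    (hr : ∀ x ∈ S, ∀ y ∈ S, c ≤ I.routeCost α i x y) : c ≤ I.cost α S i := by
  refine Finset.le_min' _ _ _ fun d hd => ?_
  rcases Finset.mem_insert.1 hd with rfl | hd
  · exact hw
  · obtain ⟨⟨x, y⟩, hxy, rfl⟩ := Finset.mem_image.1 hd
    exact hr x (Finset.mem_product.1 hxy).1 y (Finset.mem_product.1 hxy).2

/-- If `S` separates every stop of `T` from both terminals of an agent, then the agent does not
prefer `T` to `S`. -/
lemma cost_le_cost_of_separated (hα₀ : 0 ≤ α) (hα₁ : α ≤ 1) {S T : Finset ℚ} {i : N}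
    (hl : ∀ x ∈ T, ∃ s ∈ S, s ∈ Set.uIcc (I.left i) x)
    (hr : ∀ x ∈ T, ∃ s ∈ S, s ∈ Set.uIcc (I.right i) x) : I.cost α S i ≤ I.cost α T i := by
  refine I.le_cost (I.cost_le_walk S i) fun x hx y hy => ?_
  obtain ⟨s, hs, hsx⟩ := hl x hx
  obtain ⟨t, ht, hty⟩ := hr y hy
  exact (I.cost_le_routeCost i hs ht).trans (I.routeCost_le_of_mem_uIcc hα₀ hα₁ hsx hty)

end BusStopInstance

open Classical in
/-- Finitely many points on a line can be separated by few of them into groups of size at most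
`G`. -/
lemma exists_finset_separating {ι β : Type*} [LinearOrder β] (p : ι → β) (G : ℕ) (E : Finset ι) :
    ∃ S : Finset β, S ⊆ E.image p ∧ S.card * (G + 1) ≤ E.card ∧
      ∀ t, (E.filter fun e => ∀ s ∈ S, s ∉ Set.uIcc (p e) t).card ≤ G := by
  induction E using Finset.strongInduction with
  | H E ih =>
    by_cases hE : E.card ≤ G
    · exact ⟨∅, by simp, by simp, fun t => (Finset.card_filter_le _ _).trans hE⟩
    -- Sweep from the left: cut at the first point `s` with at least `G + 1` points at or before it,
    -- then recurse on the points beyond `s`.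
    have hne : ((E.image p).filter fun s => G + 1 ≤ (E.filter (p · ≤ s)).card).Nonempty := by
      have hEne : E.Nonempty := Finset.card_pos.1 (by omega)
      refine ⟨(E.image p).max' (hEne.image p),
        Finset.mem_filter.2 ⟨Finset.max'_mem _ _, ?_⟩⟩
      rw [Finset.filter_true_of_mem
        fun e he => Finset.le_max' _ _ (Finset.mem_image_of_mem p he)]
      omega
    obtain ⟨s, hs, hmin⟩ := Finset.exists_min_image _ id hne
    obtain ⟨hsE, hsG⟩ := Finset.mem_filter.1 hs
    have hlt : (E.filter (p · < s)).card ≤ G := by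
      rcases (E.filter (p · < s)).eq_empty_or_nonempty with h0 | h0
      · simp [h0]
      obtain ⟨e, he, hmax⟩ := Finset.exists_max_image _ p h0
      obtain ⟨heE, hes⟩ := Finset.mem_filter.1 he
      -- Otherwise the last point before `s` would already have been a place to cut.
      by_contra! hcon
      refine absurd (hmin (p e) (Finset.mem_filter.2 ⟨Finset.mem_image_of_mem p heE, ?_⟩))
        (not_le.2 hes)
      refine hcon.trans_le (Finset.card_le_card fun a ha => ?_)
      exact Finset.mem_filter.2 ⟨(Finset.mem_filter.1 ha).1, hmax a ha⟩
    have hcard := Finset.card_filter_add_card_filter_not (s := E) (p · ≤ s)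
    have hss : (E.filter fun e => ¬ p e ≤ s) ⊂ E := by
      refine (Finset.filter_subset _ _).ssubset_of_ne fun h => ?_
      rw [h] at hcard
      omega
    obtain ⟨S, hSE, hSc, hSG⟩ := ih _ hss
    refine ⟨insert s S, ?_, ?_, fun t => ?_⟩
    · exact Finset.insert_subset hsE
        (hSE.trans (Finset.image_subset_image (Finset.filter_subset _ _)))
    · have := Nat.mul_le_mul_right (G + 1) (Finset.card_insert_le s S)
      linarith
    -- The cut `s` leaves only points on the same side as `t`: those strictly before `s`, or those
    -- of the recursive call.
    · rcases le_or_gt t s with hts | hts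
      · refine (Finset.card_le_card fun e he => ?_).trans hlt
        obtain ⟨heE, he⟩ := Finset.mem_filter.1 he
        refine Finset.mem_filter.2 ⟨heE, ?_⟩
        by_contra! hse
        exact he s (Finset.mem_insert_self _ _) (Set.mem_uIcc.2 (Or.inr ⟨hts, hse⟩))
      · refine (Finset.card_le_card fun e he => ?_).trans (hSG t)
        obtain ⟨heE, he⟩ := Finset.mem_filter.1 he
        refine Finset.mem_filter.2 ⟨Finset.mem_filter.2 ⟨heE, fun hse => ?_⟩,
          fun a ha => he a (Finset.mem_insert_of_mem ha)⟩
        exact he s (Finset.mem_insert_self _ _) (Set.mem_uIcc.2 (Or.inl ⟨hse, hts.le⟩))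

theorem mainTheorem5 {N : Type*} [Fintype N] (α : ℝ) (hα : α ∈ Set.Ioo (0 : ℝ) 1)
    (I : BusStopInstance N) :
    ∃ S : Finset ℚ, I.IsFeasible S ∧ I.InApproxCore α 16 S := by
  classical
  have of_empty : ∀ S : Finset ℚ, ∀ M : Finset N, M.Nonempty →
      ∃ i ∈ M, I.cost α S i ≤ I.cost α ∅ i := fun S M ⟨i, hi⟩ =>
    ⟨i, hi, I.cost_le_cost_of_separated hα.1.le hα.2.le (by simp) (by simp)⟩
  -- For budget `0`, `G` would be the junk value `2n / 0 = 0`, and the bound on `|S|` would fail.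
  rcases Nat.eq_zero_or_pos I.budget with hb | hb
  · refine ⟨∅, ⟨Finset.empty_subset _, by simp⟩, fun M hM T _ hT => ?_⟩
    have hT0 : (T.card : ℝ) ≤ 0 := by
      simp only [hb, Nat.cast_zero, zero_div, mul_zero] at hT
      linarith
    obtain rfl : T = ∅ := Finset.card_eq_zero.1 (Nat.le_zero.1 (by exact_mod_cast hT0))
    exact of_empty ∅ M hM
  let p : N ⊕ N → ℚ := Sum.elim I.left I.right
  obtain ⟨S, hSE, hSc, hSG⟩ := exists_finset_separating p (2 * Fintype.card N / I.budget) Finset.univ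
  set G := 2 * Fintype.card N / I.budget
  refine ⟨S, ⟨fun s hs => ?_, ?_⟩, fun M hM T _ hT => ?_⟩
  · obtain ⟨i | i, -, rfl⟩ := Finset.mem_image.1 (hSE hs)
    · exact I.left_mem i
    · exact I.right_mem i
  · have hE : (Finset.univ : Finset (N ⊕ N)).card = 2 * Fintype.card N := by
      rw [Finset.card_univ, Fintype.card_sum, two_mul]
    have hlt : 2 * Fintype.card N < I.budget * (G + 1) := Nat.lt_mul_div_succ _ hb
    exact (Nat.lt_of_mul_lt_mul_right ((hSc.trans hE.le).trans_lt hlt)).le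
  by_contra! hcon
  have hTne : 0 < T.card := by
    refine Finset.card_pos.2 (Finset.nonempty_iff_ne_empty.2 fun h => ?_)
    obtain ⟨i, hi, hle⟩ := of_empty S M hM
    exact (hcon i hi).not_ge (h ▸ hle)
  -- The terminals that `S` fails to separate from some stop of `T`; every agent of `M` owns one.
  let U : Finset (N ⊕ N) :=
    T.biUnion fun t => Finset.univ.filter fun e => ∀ s ∈ S, s ∉ Set.uIcc (p e) t
  have hUT : U.card ≤ T.card * G := Finset.card_biUnion_le_card_mul _ _ _ fun t _ => hSG t
  have hMU : M.card ≤ U.card := by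
    refine (Finset.card_le_card fun i hi => ?_).trans
      (Finset.card_image_le (s := U) (f := Sum.elim id id))
    by_contra hiU
    refine (hcon i hi).not_ge
      (I.cost_le_cost_of_separated hα.1.le hα.2.le (fun x hx => ?_) fun x hx => ?_)
    · by_contra! h
      exact hiU (Finset.mem_image.2 ⟨.inl i, Finset.mem_biUnion.2 ⟨x, hx, by simpa [p] using h⟩, rfl⟩)
    · by_contra! h
      exact hiU (Finset.mem_image.2 ⟨.inr i, Finset.mem_biUnion.2 ⟨x, hx, by simpa [p] using h⟩, rfl⟩)
  have hMb : M.card * I.budget ≤ T.card * (2 * Fintype.card N) :=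
    calc M.card * I.budget ≤ T.card * G * I.budget := Nat.mul_le_mul_right _ (hMU.trans hUT)
      _ = T.card * (G * I.budget) := mul_assoc _ _ _
      _ ≤ _ := Nat.mul_le_mul_left _ (Nat.div_mul_le_self _ _)
  have hn : (0 : ℝ) < Fintype.card N := by
    exact_mod_cast Fintype.card_pos_iff.2 ⟨hM.choose⟩
  rw [← mul_div_assoc, le_div_iff₀ hn] at hT
  have hMb' : (M.card : ℝ) * I.budget ≤ T.card * (2 * Fintype.card N) := by exact_mod_cast hMb
  have hpos : 0 < (T.card : ℝ) * Fintype.card N := mul_pos (by exact_mod_cast hTne) hn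
  -- `16 |T| n ≤ |M| b ≤ 2 |T| n` with `|T| n > 0`; any constant above `2` would do.
  linarith
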